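/- Let $\mathbb H$ be a Hadamard manifold (a complete, simply connected, finite-dimensional smooth Riemannian manifold of nonpositive sectional curvature) with exponential maps $\exp_p:T_p\mathbb H\to\mathbb H$, and let $S\subseteq\mathbb H$ be a nonempty geodesic convex set, i.e. any two points of $S$ are joined by a geodesic lying in $S$. Let $h:S\times T\mathbb H\to(\mathbb R\cup\{\pm\infty\})^m$ be a vector-valued bifunction, $\Phi=(\Phi_1,\dots,\Phi_m):S\to\mathbb R^m$ a function, and $\bar p\in S$. Write $\mathbb R^m_+$ for the nonnegative orthant (for vectors with extended real entries: all entries $\ge 0$). Call $\Phi$ geodesic $h$-convex if for all $p,q\in S$ with $p\ne q$ $$\text{(A)}\quad h_i(p,\exp_p^{-1}q)\le\Phi_i(q)-\Phi_i(p)\quad(i=1,\dots,m),$$ and geodesic $h$-convex in the cone sense if for all $p,q\in S$ with $p\neq q$ $$\text{(B)}\quad h(p,\exp_p^{-1}q)+\Phi(p)-\Phi(q)\notin\mathbb R^m_+\setminus\{0\}.$$ Consider the nonsmooth vector optimization problem (NVOP) of minimizing $\Phi$ over $S$. Call $\bar p$ a weakly efficient solution of NVOP if $\Phi(q)-\Phi(\bar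 p)\in\operatorname{int}\mathbb R^m_+$ for all $q\in S$ with $q\ne\bar p$, and an efficient solution of NVOP if $\Phi(q)-\Phi(\bar p)\notin-\mathbb R^m_+\setminus\{0\}$ for all $q\in S$. Call $\bar p$ a solution of the Minty type nonsmooth vector variational inequality problem (MNVVIP) if $$h(q,\exp_q^{-1}\bar p)\notin\mathbb R^m_+\setminus\{0\}\qquad\text{for all }q\in S,\ q\ne\bar p.$$ Then: 1. If $\Phi$ is geodesic $h$-convex in the sense of (A) or of (B), and $\bar p$ is a weakly efficient solution of NVOP, then $\bar p$ is a solution of MNVVIP. 2. If $\Phi$ is geodesic $h$-convex in the sense of (A), and $\bar p$ is an efficient solution of NVOP, then $\bar p$ is a solution of MNVVIP. -/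

import Mathlib

open Set Bundle
open scoped Manifold ContDiff Bundle

noncomputable section

namespace Hadamard

/-- The coordinate space `ℝⁿ` on which the manifolds are modelled. -/
abbrev Coord (n : ℕ) : Type := EuclideanSpace ℝ (Fin n)

section Geometry

variable {n : ℕ} {M : Type*} [TopologicalSpace M] [ChartedSpace (Coord n) M]

/-- The `i`-th coordinate vector field `∂ᵢ` of the chart around `x₀`, at the point with
coordinates `u`. -/
def coordVec (x₀ : M) (u : Coord n) (i : Fin n) :
    TangentSpace (𝓡 n) ((extChartAt (𝓡 n) x₀).symm u) :=
  mfderiv 𝓘(ℝ, Coord n) (𝓡 n) (extChartAt (𝓡 n) x₀).symm u (EuclideanSpace.single i (1 : ℝ))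

/-- The partial derivative `∂ₖ f` of a function of the coordinates. -/
def partialDeriv (k : Fin n) (f : Coord n → ℝ) (u : Coord n) : ℝ :=
  fderiv ℝ f u (EuclideanSpace.single k (1 : ℝ))

variable [RiemannianBundle (fun x : M ↦ TangentSpace (𝓡 n) x)]

/-- The coefficients `gᵢⱼ = ⟨∂ᵢ, ∂ⱼ⟩` of the Riemannian metric in the chart around `x₀`. -/
def metricCoeff (x₀ : M) (u : Coord n) : Matrix (Fin n) (Fin n) ℝ :=
  fun i j ↦ inner ℝ (coordVec x₀ u i) (coordVec x₀ u j)

/-- The Christoffel symbols `Γᵏᵢⱼ` of the Levi-Civita connection in the chart around `x₀`. -/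
def christoffel (x₀ : M) (k i j : Fin n) (u : Coord n) : ℝ :=
  (1 / 2 : ℝ) * ∑ l, (metricCoeff x₀ u)⁻¹ k l *
    (partialDeriv i (fun y ↦ metricCoeff x₀ y j l) u
      + partialDeriv j (fun y ↦ metricCoeff x₀ y i l) u
      - partialDeriv l (fun y ↦ metricCoeff x₀ y i j) u)

/-- The components of the curvature tensor in the chart around `x₀`:
`R(∂ᵢ, ∂ⱼ) ∂ₖ = ∑ l, curvatureCoeff x₀ l k i j • ∂ₗ`, where
`R(X, Y) Z = ∇_X ∇_Y Z - ∇_Y ∇_X Z - ∇_[X,Y] Z`. -/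
def curvatureCoeff (x₀ : M) (l k i j : Fin n) (u : Coord n) : ℝ :=
  partialDeriv i (christoffel x₀ l j k) u - partialDeriv j (christoffel x₀ l i k) u
    + ∑ r, (christoffel x₀ r j k u * christoffel x₀ l i r u
      - christoffel x₀ r i k u * christoffel x₀ l j r u)

/-- The scalar product of two tangent vectors with components `a`, `b` in the chart. -/
def coordInner (x₀ : M) (u : Coord n) (a b : Fin n → ℝ) : ℝ :=
  ∑ i, ∑ j, metricCoeff x₀ u i j * a i * b j

/-- The sectional curvature `⟨R(a, b) b, a⟩ / (|a|² |b|² - ⟨a, b⟩²)` of the plane spanned by the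
tangent vectors with components `a`, `b` in the chart around `x₀`. -/
def sectionalCurvature (x₀ : M) (u : Coord n) (a b : Fin n → ℝ) : ℝ :=
  coordInner x₀ u (fun l ↦ ∑ i, ∑ j, ∑ k, curvatureCoeff x₀ l k i j u * a i * b j * b k) a /
    (coordInner x₀ u a a * coordInner x₀ u b b - coordInner x₀ u a b ^ 2)

/-- The curve `γ` is a (smooth, affinely parametrized) geodesic on `s`, where `s` is an interval:
in each chart it satisfies `(γᵏ)'' + ∑ Γᵏᵢⱼ (γⁱ)' (γʲ)' = 0`, that is, `∇_{γ'} γ' = 0`. -/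
def IsGeodesicOn (γ : ℝ → M) (s : Set ℝ) : Prop :=
  ContMDiffOn 𝓘(ℝ, ℝ) (𝓡 n) ∞ γ s ∧
    ∀ x₀ : M, ∀ t ∈ s, γ t ∈ (extChartAt (𝓡 n) x₀).source →
      ∀ k : Fin n,
        let c : Fin n → ℝ → ℝ := fun i τ ↦ (extChartAt (𝓡 n) x₀ (γ τ)) i
        derivWithin (derivWithin (c k) s) s t
          + ∑ i, ∑ j, christoffel x₀ k i j (extChartAt (𝓡 n) x₀ (γ t))
              * derivWithin (c i) s t * derivWithin (c j) s t = 0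

/-- The (complete) curve `γ : ℝ → M` is a geodesic with `γ(0) = p` and `γ'(0) = v`. -/
def IsGeodesicFrom (p : M) (v : TangentSpace (𝓡 n) p) (γ : ℝ → M) : Prop :=
  IsGeodesicOn (n := n) γ univ ∧
    (⟨γ 0, mfderiv 𝓘(ℝ, ℝ) (𝓡 n) γ 0 (1 : ℝ)⟩ : TangentBundle (𝓡 n) M) = ⟨p, v⟩

open Classical in
/-- The exponential map of a complete Riemannian manifold: `exp_p v = γ(1)` for the geodesic `γ`
with `γ(0) = p` and `γ'(0) = v`. -/
def expMap (p : M) (v : TangentSpace (𝓡 n) p) : M :=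
  if hγ : ∃ γ : ℝ → M, IsGeodesicFrom p v γ then hγ.choose 1 else p

/-- The inverse `exp_p⁻¹` of the exponential map, which is a bijection on a Hadamard manifold. -/
def expInv (p q : M) : TangentSpace (𝓡 n) p :=
  Function.invFun (expMap (n := n) p) q

variable (n) in
/-- A set is geodesic convex if any two of its points are joined by a geodesic lying in it. -/
def GeodesicConvex (S : Set M) : Prop :=
  ∀ p ∈ S, ∀ q ∈ S, ∃ γ : ℝ → M, IsGeodesicOn (n := n) γ (Icc 0 1) ∧
    γ 0 = p ∧ γ 1 = q ∧ ∀ t ∈ Icc (0 : ℝ) 1, γ t ∈ S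

end Geometry

/-- A Hadamard manifold: a smooth Riemannian manifold of dimension `n` that is complete, simply
connected and of nonpositive sectional curvature. -/
class IsHadamardManifold (n : ℕ) (M : Type*) [MetricSpace M] [ChartedSpace (Coord n) M]
    [RiemannianBundle (fun x : M ↦ TangentSpace (𝓡 n) x)] : Prop where
  smooth : IsManifold (𝓡 n) ∞ M
  smooth_metric : IsContMDiffRiemannianBundle (𝓡 n) ∞ (Coord n)
    (fun x : M ↦ TangentSpace (𝓡 n) x)
  riemannian_dist : IsRiemannianManifold (𝓡 n) M
  complete : CompleteSpace M
  simply_connected : SimplyConnectedSpace M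
  sectional_nonpos : ∀ x₀ : M, ∀ u ∈ (extChartAt (𝓡 n) x₀).target, ∀ a b : Fin n → ℝ,
    LinearIndependent ℝ ![a, b] → sectionalCurvature x₀ u a b ≤ 0

section VectorOptimization

variable {n m : ℕ} {M : Type*} [TopologicalSpace M] [ChartedSpace (Coord n) M]
  [RiemannianBundle (fun x : M ↦ TangentSpace (𝓡 n) x)] {S : Set M}

/-- `h(p, exp_p⁻¹ q)`, for a bifunction `h : S × TM → (ℝ ∪ {±∞})ᵐ`. -/
def bifun (h : S → TangentBundle (𝓡 n) M → Fin m → EReal) (p q : S) : Fin m → EReal :=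
  h p ⟨p, expInv (n := n) (p : M) q⟩

/-- Geodesic `h`-convexity, in the form of the inequality
`h(p, exp_p⁻¹ q) ≦ Φ(q) - Φ(p)` between vectors. -/
def GeodesicHConvex (h : S → TangentBundle (𝓡 n) M → Fin m → EReal) (Φ : S → Fin m → ℝ) : Prop :=
  ∀ p q : S, p ≠ q → ∀ i, bifun h p q i ≤ ((Φ q i - Φ p i : ℝ) : EReal)

/-- Geodesic `h`-convexity, in the form
`h(p, exp_p⁻¹ q) + Φ(p) - Φ(q) ∉ ℝᵐ₊ \ {0}`; the orthant is taken in the extended reals. -/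
def GeodesicHConvexCone (h : S → TangentBundle (𝓡 n) M → Fin m → EReal) (Φ : S → Fin m → ℝ) :
    Prop :=
  ∀ p q : S, p ≠ q →
    (fun i ↦ bifun h p q i + ((Φ p i : ℝ) : EReal) - ((Φ q i : ℝ) : EReal)) ∉
      Ici (0 : Fin m → EReal) \ {0}

/-- `pbar` is an efficient solution of the problem of minimizing `Φ` over `S`. -/
def IsEfficient (Φ : S → Fin m → ℝ) (pbar : S) : Prop :=
  ∀ q : S, Φ q - Φ pbar ∉ Iic (0 : Fin m → ℝ) \ {0}

/-- `pbar` is a weakly efficient solution of the problem of minimizing `Φ` over `S`, in the sense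
that `Φ(q) - Φ(pbar)` lies in the interior of `ℝᵐ₊` for all other points `q` of `S`. -/
def IsWeaklyEfficient (Φ : S → Fin m → ℝ) (pbar : S) : Prop :=
  ∀ q : S, q ≠ pbar → Φ q - Φ pbar ∈ interior (Ici (0 : Fin m → ℝ))

/-- `pbar` solves the Minty type nonsmooth vector variational inequality problem:
`h(q, exp_q⁻¹ pbar) ∉ ℝᵐ₊ \ {0}` for all other points `q` of `S`; the orthant is taken in the
extended reals. -/
def SolvesMNVVIP (h : S → TangentBundle (𝓡 n) M → Fin m → EReal) (pbar : S) : Prop :=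
  ∀ q : S, q ≠ pbar → bifun h q pbar ∉ Ici (0 : Fin m → EReal) \ {0}

end VectorOptimization

end Hadamard

end

namespace Hadamard

/-! Argue by contradiction at a point `q` where the value of `h` towards `pbar` lies in the orthant
minus the origin. Under (A) this value is bounded above by `Φ pbar - Φ q`, which is then
nonnegative; efficiency makes it zero, and the value of `h` is squeezed to zero. Under (B), weak
efficiency makes every entry of `Φ q - Φ pbar` positive, so adding it to the nonnegative `h` gives a
vector that (B) forbids. -/

theorem pos_of_mem_interior_Ici {m : ℕ} {x : Fin m → ℝ}
    (hx : x ∈ interior (Ici (0 : Fin m → ℝ))) (i : Fin m) : 0 < x i := by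
  rw [← Set.pi_univ_Ici, interior_pi_set Set.finite_univ] at hx
  simpa using hx i (mem_univ i)

/-- A vector of `ℝᵐ₊ \ {0}` with extended real entries has an index, so `m ≠ 0`. -/
theorem nonempty_fin_of_ne_zero {m : ℕ} {x : Fin m → EReal} (hx : x ≠ 0) : Nonempty (Fin m) := by
  obtain ⟨i, -⟩ := Function.ne_iff.mp hx
  exact ⟨i⟩

/-- Since `x` may be `⊤`, the two real terms are first grouped into one positive real, to which `x`
only adds. -/
theorem add_coe_sub_coe_pos {x : EReal} (hx : 0 ≤ x) {a b : ℝ} (hab : b < a) :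
    0 < x + (a : EReal) - (b : EReal) := by
  have hab' : (0 : EReal) < ((a - b : ℝ) : EReal) := EReal.coe_pos.mpr (sub_pos.mpr hab)
  calc (0 : EReal) < ((a - b : ℝ) : EReal) := hab'
    _ ≤ x + ((a - b : ℝ) : EReal) := le_add_of_nonneg_left hx
    _ = x + (a : EReal) - (b : EReal) := by rw [EReal.coe_sub, sub_eq_add_neg, sub_eq_add_neg,
      add_assoc]

section

variable {n m : ℕ} {M : Type*} [TopologicalSpace M] [ChartedSpace (Coord n) M]
  [RiemannianBundle (fun x : M ↦ TangentSpace (𝓡 n) x)] {S : Set M}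
  {h : S → TangentBundle (𝓡 n) M → Fin m → EReal} {Φ : S → Fin m → ℝ} {pbar : S}

theorem IsWeaklyEfficient.lt (hp : IsWeaklyEfficient Φ pbar) {q : S} (hq : q ≠ pbar) (i : Fin m) :
    Φ pbar i < Φ q i :=
  sub_pos.mp (pos_of_mem_interior_Ici (hp q hq) i)

/-- Weak efficiency in this sense is strict domination in every coordinate, so a single coordinate
already gives the contradiction; it exists because the difference is nonzero. -/
theorem IsWeaklyEfficient.isEfficient (hp : IsWeaklyEfficient Φ pbar) : IsEfficient Φ pbar := by
  rintro q ⟨hle, hne⟩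
  obtain ⟨i, hi⟩ := Function.ne_iff.mp hne
  have hq : q ≠ pbar := by
    rintro rfl
    simp at hi
  have h₁ : Φ q i - Φ pbar i ≤ 0 := hle i
  linarith [hp.lt hq i]

theorem GeodesicHConvex.solvesMNVVIP (hΦ : GeodesicHConvex h Φ) (hp : IsEfficient Φ pbar) :
    SolvesMNVVIP h pbar := by
  rintro q hq ⟨hnonneg, hne⟩
  have hle : ∀ i, bifun h q pbar i ≤ ((Φ pbar i - Φ q i : ℝ) : EReal) := hΦ q pbar hq
  have hmem : Φ q - Φ pbar ∈ Iic (0 : Fin m → ℝ) := fun i ↦ by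
    have hi : (0 : ℝ) ≤ Φ pbar i - Φ q i := EReal.coe_nonneg.mp ((hnonneg i).trans (hle i))
    simpa using hi
  have heq : Φ q - Φ pbar = 0 := by
    by_contra hne'
    exact hp q ⟨hmem, hne'⟩
  -- The upper bound from (A) is now zero, which leaves the nonnegative `h` no room.
  refine hne (funext fun i ↦ le_antisymm ?_ (hnonneg i))
  have hi : Φ pbar i - Φ q i = 0 := by
    have := congrFun heq i
    simp only [Pi.sub_apply, Pi.zero_apply] at this
    linarith
  simpa [hi] using hle i

/-- Efficiency alone would let `Φ q - Φ pbar` have a negative entry, and the sum in (B) could then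
leave the orthant. -/
theorem GeodesicHConvexCone.solvesMNVVIP (hΦ : GeodesicHConvexCone h Φ)
    (hp : IsWeaklyEfficient Φ pbar) : SolvesMNVVIP h pbar := by
  rintro q hq ⟨hnonneg, hne⟩
  -- For `m = 0`, entrywise positivity would not make the sum nonzero, so an index is needed.
  obtain ⟨i⟩ := nonempty_fin_of_ne_zero hne
  have hpos := fun i ↦ add_coe_sub_coe_pos (hnonneg i) (hp.lt hq i)
  exact hΦ q pbar hq ⟨fun i ↦ (hpos i).le, fun h₀ ↦ (hpos i).ne' (congrFun h₀ i)⟩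

end

end Hadamard

theorem mainTheorem5 {n m : ℕ} {M : Type*} [MetricSpace M] [ChartedSpace (Hadamard.Coord n) M]
    [RiemannianBundle (fun x : M ↦ TangentSpace (𝓡 n) x)] [Hadamard.IsHadamardManifold n M]
    (S : Set M) (hS : S.Nonempty) (hSconv : Hadamard.GeodesicConvex n S)
    (h : S → TangentBundle (𝓡 n) M → Fin m → EReal) (Φ : S → Fin m → ℝ) (pbar : S) :
    (Hadamard.GeodesicHConvex h Φ ∨ Hadamard.GeodesicHConvexCone h Φ →
      Hadamard.IsWeaklyEfficient Φ pbar → Hadamard.SolvesMNVVIP h pbar) ∧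
    (Hadamard.GeodesicHConvex h Φ →
      Hadamard.IsEfficient Φ pbar → Hadamard.SolvesMNVVIP h pbar) := by
  refine ⟨fun hΦ hp ↦ ?_, fun hΦ hp ↦ hΦ.solvesMNVVIP hp⟩
  rcases hΦ with hA | hB
  · exact hA.solvesMNVVIP hp.isEfficient
  · exact hB.solvesMNVVIP hp
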